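/- Let $d\ge 1$ and $K\ge 0$ be integers and let $X_1,\dots,X_K$ be independent random Hermitian $d\times d$ complex matrices on a common probability space. For a Hermitian matrix $A$ let $\lambda_{\max}(A)$ denote its largest eigenvalue, let $e^{A}$ be the matrix exponential, and, for $A$ positive definite, let $\log A$ be the matrix logarithm (obtained by applying $\log$ to the eigenvalues of $A$ in an orthonormal eigenbasis). Expectations of random matrices are taken entrywise. Then for every $\epsilon>0$, $$\mathbb{P}\Big\{\lambda_{\max}\Big(\sum_{k=1}^K X_k\Big)\le \epsilon\Big\}\;\le\;\inf_{\theta>0}\Big\{e^{\theta\epsilon}\cdot\exp\Big(\lambda_{\max}\Big(\sum_{k=1}^K\log \mathbb{E}\,e^{-\theta X_k}\Big)\Big)\Big\},$$ where the infimum runs over those $\theta>0$ for which all the expectations $\mathbb{E}\,e^{-\theta X_k}$, $k=1,\dots,K$, exist (i.e. all entries of $e^{-\theta X_k}$ are integrable). The expression in braces is read as $+\infty$ for any other $\theta$, and the infimum is $+\infty$ if there is no such $\theta$. -/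

import Mathlib

open MeasureTheory ProbabilityTheory
open scoped ENNReal

namespace SmallDeviation

/-- The entrywise (product) sigma-algebra on complex `d × d` matrices. -/
noncomputable instance instMeasurableSpaceMatrix (d : ℕ) : MeasurableSpace (Matrix (Fin d) (Fin d) ℂ) :=
  (inferInstance : MeasurableSpace (Fin d → Fin d → ℂ))

/-- The product sigma-algebra is the Borel sigma-algebra. -/
instance instBorelSpaceMatrix (d : ℕ) : BorelSpace (Matrix (Fin d) (Fin d) ℂ) :=
  (inferInstance : BorelSpace (Fin d → Fin d → ℂ))

/-- The largest eigenvalue of a Hermitian matrix of size `d ≥ 1`, as the supremum of its (finite,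
nonempty) real spectrum; see `isGreatest_lambdaMax` and `lambdaMax_eq_sup'`. -/
noncomputable def lambdaMax {d : ℕ} (A : Matrix (Fin d) (Fin d) ℂ) : ℝ :=
  sSup (spectrum ℝ A)

theorem isGreatest_lambdaMax {d : ℕ} [NeZero d] {A : Matrix (Fin d) (Fin d) ℂ}
    (hA : A.IsHermitian) : IsGreatest (Set.range hA.eigenvalues) (lambdaMax A) := by
  rw [lambdaMax, hA.spectrum_real_eq_range_eigenvalues]
  exact (Set.finite_range _).isCompact.isGreatest_sSup (Set.range_nonempty _)

theorem lambdaMax_eq_sup' {d : ℕ} [NeZero d] {A : Matrix (Fin d) (Fin d) ℂ}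
    (hA : A.IsHermitian) :
    lambdaMax A = Finset.univ.sup' Finset.univ_nonempty hA.eigenvalues := by
  refine (isGreatest_lambdaMax hA).unique ⟨?_, ?_⟩
  · obtain ⟨i, -, hi⟩ := Finset.exists_mem_eq_sup' Finset.univ_nonempty hA.eigenvalues
    exact ⟨i, hi.symm⟩
  · rintro _ ⟨i, rfl⟩
    exact Finset.le_sup' _ (Finset.mem_univ i)

/-- The logarithm of a Hermitian matrix by functional calculus, `U · log Λ · U*`. -/
noncomputable def matLog {d : ℕ} (A : Matrix (Fin d) (Fin d) ℂ) : Matrix (Fin d) (Fin d) ℂ :=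
  cfc Real.log A

/-- For a Hermitian matrix, `matLog` applies `log` to the eigenvalues in an eigenbasis. -/
theorem matLog_eq {d : ℕ} {A : Matrix (Fin d) (Fin d) ℂ} (hA : A.IsHermitian) :
    matLog A = (hA.eigenvectorUnitary : Matrix (Fin d) (Fin d) ℂ)
      * Matrix.diagonal (fun i => ((Real.log (hA.eigenvalues i) : ℝ) : ℂ))
      * star (hA.eigenvectorUnitary : Matrix (Fin d) (Fin d) ℂ) := by
  rw [matLog, hA.cfc_eq]
  rfl

theorem isHermitian_matLog {d : ℕ} (A : Matrix (Fin d) (Fin d) ℂ) : (matLog A).IsHermitian :=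
  cfc_predicate Real.log A

/-- The expectation `E Z` of a random matrix exists: every entry is integrable. -/
def HasExpectation {Ω : Type*} [MeasurableSpace Ω] {d : ℕ}
    (Z : Ω → Matrix (Fin d) (Fin d) ℂ) (P : Measure Ω) : Prop :=
  ∀ i j, Integrable (fun ω => Z ω i j) P

/-- The entrywise expectation `E Z` of a random matrix. -/
noncomputable def expectation {Ω : Type*} [MeasurableSpace Ω] {d : ℕ}
    (Z : Ω → Matrix (Fin d) (Fin d) ℂ) (P : Measure Ω) : Matrix (Fin d) (Fin d) ℂ :=
  Matrix.of fun i j => ∫ ω, Z ω i j ∂P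

/-- The random matrix `exp (-θ X)` (`NormedSpace.exp` is the power-series exponential). -/
noncomputable def expNeg {Ω : Type*} {d : ℕ} (θ : ℝ) (X : Ω → Matrix (Fin d) (Fin d) ℂ) :
    Ω → Matrix (Fin d) (Fin d) ℂ :=
  fun ω => NormedSpace.exp (-(θ • X ω))

end SmallDeviation

namespace SmallDeviation

section CStar

variable {A : Type*} [CStarAlgebra A]

/-! If λ_max(∑ X_k) ≤ ε, then λ_min(-θ ∑ X_k) ≥ -θε, so Markov's inequality reduces the claim to
bounding E exp λ_min(∑ Y_k) with Y_k = -θX_k. The core is E exp λ_min(H + Y) ≤ exp λ_min(H + log E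
e^Y) for fixed H (`lintegral_expMin_add_le`). It needs only operator concavity of log, no trace
inequality: with l = λ_min(H + Y), the matrix e^{-l} e^Y has logarithm Y - l ≥ -H, and {a > 0 : log
a ≥ -H} is closed and convex, so it contains averages. Independence lets the Y_k be replaced one at
a time by log E e^{Y_k}. Bounding the final λ_min by λ_max gives the stated form. -/

/-- For self-adjoint `a`, this is the exponential of the least spectral value of `a`. -/
noncomputable def expMin (a : A) : ℝ := ‖NormedSpace.exp (-a)‖⁻¹

theorem isUnit_exp (a : A) : IsUnit (NormedSpace.exp a) := by
  let +nondep : NormedAlgebra ℚ A := .restrictScalars ℚ ℂ A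
  exact NormedSpace.isUnit_exp a

theorem continuous_expMin [Nontrivial A] : Continuous (expMin : A → ℝ) := by
  let +nondep : NormedAlgebra ℚ A := .restrictScalars ℚ ℂ A
  have := NormedSpace.exp_continuous (𝔸 := A)
  exact Continuous.inv₀ (by fun_prop) fun a => norm_ne_zero_iff.2 (isUnit_exp (-a)).ne_zero

theorem expMin_pos [Nontrivial A] (a : A) : 0 < expMin a :=
  inv_pos.2 (norm_pos_iff.2 (isUnit_exp (-a)).ne_zero)

variable [PartialOrder A] [StarOrderedRing A]

/-- As `exp (-a)` is nonnegative, its norm bound is an order bound by a scalar, which is read off on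
the spectrum of `a`. -/
theorem le_expMin_iff [Nontrivial A] {a : A} (ha : IsSelfAdjoint a) {r : ℝ} :
    Real.exp r ≤ expMin a ↔ algebraMap ℝ A r ≤ a := by
  have hcfc : NormedSpace.exp (-a) = cfc (fun x : ℝ => Real.exp (-x)) a := by
    rw [← CFC.real_exp_eq_normedSpace_exp ha.neg, cfc_comp_neg Real.exp a]
  have hpos := inv_pos.1 (expMin_pos a)
  rw [expMin, le_inv_comm₀ (Real.exp_pos r) hpos, ← Real.exp_neg,
    CStarAlgebra.norm_le_iff_le_algebraMap _ (Real.exp_nonneg _) ha.neg.exp_nonneg, hcfc,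
    cfc_le_algebraMap_iff _ _ a, algebraMap_le_iff_le_spectrum]
  simp

theorem algebraMap_log_expMin_le [Nontrivial A] {a : A} (ha : IsSelfAdjoint a) :
    algebraMap ℝ A (Real.log (expMin a)) ≤ a :=
  (le_expMin_iff ha).1 (Real.exp_log (expMin_pos a)).le

theorem expMin_le_exp_sSup_spectrum [Nontrivial A] {a : A} (ha : IsSelfAdjoint a) :
    expMin a ≤ Real.exp (sSup (spectrum ℝ a)) := by
  obtain ⟨x, hx⟩ := ContinuousFunctionalCalculus.spectrum_nonempty (R := ℝ) a ha
  rw [← Real.log_le_iff_le_exp (expMin_pos a)]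
  exact ((algebraMap_le_iff_le_spectrum (R := ℝ) (a := a)).1 (algebraMap_log_expMin_le ha) x hx).trans
    (le_csSup (ContinuousFunctionalCalculus.isCompact_spectrum a).bddAbove hx)

theorem exp_neg_le_expMin_of_sSup_spectrum_le [Nontrivial A] {a : A} (ha : IsSelfAdjoint a) {r : ℝ}
    (h : sSup (spectrum ℝ a) ≤ r) {t : ℝ} (ht : 0 ≤ t) :
    Real.exp (-(t * r)) ≤ expMin (-(t • a)) := by
  have hle : a ≤ algebraMap ℝ A r := (le_algebraMap_iff_spectrum_le (R := ℝ) (a := a)).2 fun x hx =>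
    (le_csSup (ContinuousFunctionalCalculus.isCompact_spectrum a).bddAbove hx).trans h
  rw [le_expMin_iff ((IsSelfAdjoint.all t).smul ha).neg, map_neg, neg_le_neg_iff,
    Algebra.algebraMap_eq_smul_one, mul_smul, ← Algebra.algebraMap_eq_smul_one]
  exact smul_le_smul_of_nonneg_left hle ht

theorem isStrictlyPositive_of_algebraMap_le {a : A} {r : ℝ} (hr : 0 < r)
    (h : algebraMap ℝ A r ≤ a) : IsStrictlyPositive a :=
  (isStrictlyPositive_algebraMap hr).of_le h

theorem isStrictlyPositive_exp {a : A} (ha : IsSelfAdjoint a) :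
    IsStrictlyPositive (NormedSpace.exp a) :=
  (isUnit_exp a).isStrictlyPositive ha.exp_nonneg

/-- The exponential is not operator monotone, but comparison with a scalar only involves the
spectrum. -/
theorem algebraMap_exp_le_of_algebraMap_le_log {a : A} (ha : IsStrictlyPositive a) {r : ℝ}
    (h : algebraMap ℝ A r ≤ CFC.log a) : algebraMap ℝ A (Real.exp r) ≤ a := by
  rw [← CFC.exp_log a ha, ← CFC.real_exp_eq_normedSpace_exp .log, algebraMap_le_cfc_iff _ _ _]
  exact fun x hx => Real.exp_le_exp.2 ((algebraMap_le_iff_le_spectrum (R := ℝ)).1 h x hx)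

theorem convex_le_log (b : A) : Convex ℝ {a : A | IsStrictlyPositive a ∧ b ≤ CFC.log a} :=
  CFC.concaveOn_log.convex_ge b

/-- The logarithm is continuous only away from singular elements. Since `b ≥ -‖b‖`, the condition
forces `a ≥ exp (-‖b‖)`, a closed region where it is continuous. -/
theorem isClosed_le_log {b : A} (hb : IsSelfAdjoint b) :
    IsClosed {a : A | IsStrictlyPositive a ∧ b ≤ CFC.log a} := by
  set c : ℝ := Real.exp (-‖b‖)
  have hc : 0 < c := Real.exp_pos _
  have hset : {a : A | IsStrictlyPositive a ∧ b ≤ CFC.log a} =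
      Set.Ici (algebraMap ℝ A c) ∩ CFC.log ⁻¹' Set.Ici b := by
    ext a
    refine ⟨fun h => ⟨algebraMap_exp_le_of_algebraMap_le_log h.1 ?_, h.2⟩,
      fun h => ⟨isStrictlyPositive_of_algebraMap_le hc h.1, h.2⟩⟩
    rw [map_neg]
    exact hb.neg_algebraMap_norm_le_self.trans h.2
  rw [hset]
  refine ContinuousOn.preimage_isClosed_of_isClosed (CFC.continuousOn_log.mono fun a ha => ?_)
    isClosed_Ici isClosed_Ici
  have := isStrictlyPositive_of_algebraMap_le hc ha
  exact ⟨this.isSelfAdjoint, this.isUnit⟩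

/-- Supplies the integrable majorant for `expMin (H + Y)`. -/
theorem expMin_add_le [Nontrivial A] {a b : A} (ha : IsSelfAdjoint a) (hb : IsSelfAdjoint b) :
    expMin (a + b) ≤ Real.exp ‖a‖ * ‖NormedSpace.exp b‖ := by
  have h : algebraMap ℝ A (Real.log (expMin (a + b)) - ‖a‖) ≤ b := by
    rw [map_sub, sub_le_iff_le_add']
    exact (algebraMap_log_expMin_le (ha.add hb)).trans
      (add_le_add_left ha.le_algebraMap_norm_self b)
  have h2 := algebraMap_exp_le_of_algebraMap_le_log (isStrictlyPositive_exp hb)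
    (by rwa [CFC.log_exp b hb])
  have h3 := CStarAlgebra.norm_le_norm_of_nonneg_of_le
    (algebraMap_nonneg A (Real.exp_nonneg _)) h2
  rw [norm_algebraMap', Real.norm_of_nonneg (Real.exp_nonneg _), Real.exp_sub,
    Real.exp_log (expMin_pos _), div_le_iff₀ (Real.exp_pos _)] at h3
  linarith

variable {Ω : Type*} [MeasurableSpace Ω] {P : Measure Ω} [IsProbabilityMeasure P]

theorem lintegral_expMin_add_le [Nontrivial A] {H : A} (hH : IsSelfAdjoint H) {Y : Ω → A}
    (hY : ∀ ω, IsSelfAdjoint (Y ω)) (hYm : AEStronglyMeasurable Y P)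
    (hint : Integrable (fun ω => NormedSpace.exp (Y ω)) P) :
    ∫⁻ ω, ENNReal.ofReal (expMin (H + Y ω)) ∂P ≤
      ENNReal.ofReal (expMin (H + CFC.log (∫ ω, NormedSpace.exp (Y ω) ∂P))) := by
  set M := ∫ ω, NormedSpace.exp (Y ω) ∂P
  set l : Ω → ℝ := fun ω => Real.log (expMin (H + Y ω))
  have hl : ∀ ω, Real.exp (l ω) = expMin (H + Y ω) := fun ω => Real.exp_log (expMin_pos _)
  have hfm : AEStronglyMeasurable (fun ω => expMin (H + Y ω)) P :=
    continuous_expMin.comp_aestronglyMeasurable (aestronglyMeasurable_const.add hYm)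
  have hfi : Integrable (fun ω => expMin (H + Y ω)) P :=
    (hint.norm.const_mul (Real.exp ‖H‖)).mono' hfm (.of_forall fun ω => by
      rw [Real.norm_of_nonneg (expMin_pos _).le]
      exact expMin_add_le hH (hY ω))
  have hfi' : Integrable (fun ω => Real.exp (l ω)) P := by simpa only [hl] using hfi
  rw [← ofReal_integral_eq_lintegral_ofReal hfi (.of_forall fun ω => (expMin_pos _).le)]
  refine ENNReal.ofReal_le_ofReal ?_
  simp_rw [← hl]
  set q := ∫ ω, Real.exp (l ω) ∂P
  have hq : 0 < q := integral_exp_pos hfi'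
  -- Average under the probability measure of density `exp l / q`: the density cancels the factor
  -- `exp (-l)`, so the mean of `exp (-l) • exp Y` is `q⁻¹ • M`.
  have := isProbabilityMeasure_tilted hfi'
  have hscale : ∀ ω, (Real.exp (l ω) / q) • Real.exp (-l ω) • NormedSpace.exp (Y ω) =
      q⁻¹ • NormedSpace.exp (Y ω) := fun ω => by
    rw [smul_smul, div_mul_eq_mul_div, ← Real.exp_add]
    simp
  have hmem : ∀ ω, Real.exp (-l ω) • NormedSpace.exp (Y ω) ∈
      {a : A | IsStrictlyPositive a ∧ -H ≤ CFC.log a} := fun ω => by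
    have hsp := isStrictlyPositive_exp (hY ω)
    refine ⟨hsp.smul (Real.exp_pos _), ?_⟩
    rw [CFC.log_smul' _ (Real.exp_pos _) hsp, Real.log_exp, CFC.log_exp _ (hY ω), map_neg]
    have := algebraMap_log_expMin_le (hH.add (hY ω))
    rwa [neg_add_eq_sub, le_sub_iff_add_le, neg_add_eq_sub, sub_le_iff_le_add']
  have hint' : Integrable (fun ω => Real.exp (-l ω) • NormedSpace.exp (Y ω)) (P.tilted l) := by
    rw [integrable_tilted_iff hfi']
    refine hint.congr (.of_forall fun ω => ?_)
    simp [smul_smul, ← Real.exp_add]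
  have key := (convex_le_log (-H)).integral_mem (isClosed_le_log hH.neg) (.of_forall hmem) hint'
  rw [integral_tilted] at key
  change ∫ ω, (Real.exp (l ω) / q) • Real.exp (-l ω) • NormedSpace.exp (Y ω) ∂P ∈ _ at key
  simp_rw [hscale] at key
  rw [integral_smul] at key
  obtain ⟨hk1, hk2⟩ := key
  have hM : IsStrictlyPositive M := by
    have := hk1.smul hq
    rwa [smul_inv_smul₀ hq.ne'] at this
  -- Membership of `q⁻¹ • M` now reads `-H ≤ log M - log q`, that is, `log q ≤ H + log M`.
  rw [CFC.log_smul' _ (inv_pos.2 hq) hM, Real.log_inv, map_neg, neg_add_eq_sub] at hk2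
  rw [← Real.exp_log hq, le_expMin_iff (hH.add .log)]
  rwa [le_sub_iff_add_le, neg_add_eq_sub, sub_le_iff_le_add'] at hk2

theorem lintegral_comp_of_indepFun {E F : Type*} [MeasurableSpace E] [MeasurableSpace F]
    {S : Ω → E} {T : Ω → F} (hST : IndepFun S T P) (hS : Measurable S) (hT : Measurable T)
    {g : E × F → ℝ≥0∞} (hg : Measurable g) :
    ∫⁻ ω, g (S ω, T ω) ∂P = ∫⁻ ω', ∫⁻ ω, g (S ω, T ω') ∂P ∂P := by
  have := Measure.isProbabilityMeasure_map (μ := P) hS.aemeasurable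
  have := Measure.isProbabilityMeasure_map (μ := P) hT.aemeasurable
  rw [← lintegral_map hg (hS.prodMk hT),
    (indepFun_iff_map_prod_eq_prod_map_map hS.aemeasurable hT.aemeasurable).1 hST,
    lintegral_prod_symm' _ hg, lintegral_map hg.lintegral_prod_left' hT]
  refine lintegral_congr fun ω' => ?_
  exact lintegral_map (hg.comp measurable_prodMk_right) hS

theorem lintegral_expMin_add_sum_le [Nontrivial A] [MeasurableSpace A] [BorelSpace A]
    [SecondCountableTopology A] {ι : Type*} {Y : ι → Ω → A}
    (hY : ∀ k ω, IsSelfAdjoint (Y k ω)) (hYm : ∀ k, Measurable (Y k)) (hind : iIndepFun Y P)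
    (hint : ∀ k, Integrable (fun ω => NormedSpace.exp (Y k ω)) P) (s : Finset ι) :
    ∀ {H : A}, IsSelfAdjoint H →
      ∫⁻ ω, ENNReal.ofReal (expMin (H + ∑ k ∈ s, Y k ω)) ∂P ≤
        ENNReal.ofReal (expMin (H + ∑ k ∈ s, CFC.log (∫ ω, NormedSpace.exp (Y k ω) ∂P))) := by
  classical
  induction s using Finset.induction_on with
  | empty => simp
  | insert k s hk ih =>
    intro H hH
    have hg : Measurable fun p : A × A => ENNReal.ofReal (expMin (H + p.2 + p.1)) :=
      ((continuous_expMin.comp (by fun_prop)).measurable).ennreal_ofReal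
    have hS : Measurable fun ω => ∑ j ∈ s, Y j ω := by fun_prop
    have hST : IndepFun (fun ω => ∑ j ∈ s, Y j ω) (Y k) P := by
      simpa only [Finset.sum_fn] using hind.indepFun_finsetSum_of_notMem hYm hk
    have hL : IsSelfAdjoint (∑ j ∈ s, CFC.log (∫ ω, NormedSpace.exp (Y j ω) ∂P)) :=
      isSelfAdjoint_sum _ fun _ _ => .log
    simp_rw [Finset.sum_insert hk, ← add_assoc]
    -- Freeze `Y k` at `ω'` and absorb it into the arbitrary `H` of the induction hypothesis; the
    -- logarithms thus produced join `H` when `Y k` is averaged.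
    rw [lintegral_comp_of_indepFun hST hS (hYm k) hg]
    refine (lintegral_mono fun ω' => ih (hH.add (hY k ω'))).trans ?_
    rw [add_right_comm H, lintegral_congr fun ω => by rw [add_right_comm H]]
    exact lintegral_expMin_add_le (hH.add hL) (hY k) (hYm k).aestronglyMeasurable (hint k)

end CStar

end SmallDeviation

open scoped Matrix.Norms.L2Operator MatrixOrder in
theorem SmallDeviation.measure_lambdaMax_sum_le {Ω : Type*} [MeasurableSpace Ω] {P : Measure Ω}
    [IsProbabilityMeasure P] {d : ℕ} [NeZero d] {K : ℕ} {X : Fin K → Ω → Matrix (Fin d) (Fin d) ℂ}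
    (hmeas : ∀ k, Measurable (X k)) (hherm : ∀ k ω, (X k ω).IsHermitian) (hindep : iIndepFun X P)
    (ε : ℝ) {θ : ℝ} (hθ : 0 < θ) (hexp : ∀ k, HasExpectation (expNeg θ (X k)) P) :
    P {ω | lambdaMax (∑ k, X k ω) ≤ ε} ≤
      ENNReal.ofReal (Real.exp (θ * ε) *
        Real.exp (lambdaMax (∑ k, matLog (expectation (expNeg θ (X k)) P)))) := by
  have hb : BorelSpace (Matrix (Fin d) (Fin d) ℂ) := instBorelSpaceMatrix d
  have hsc : SecondCountableTopology (Matrix (Fin d) (Fin d) ℂ) :=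
    inferInstanceAs (SecondCountableTopology (Fin d → Fin d → ℂ))
  have hint : ∀ k, Integrable (fun ω => NormedSpace.exp (-(θ • X k ω))) P := fun k => by
    -- Entrywise integrability gives Bochner integrability by expanding in matrix units.
    have hsum := integrable_finsetSum Finset.univ fun i _ =>
      integrable_finsetSum Finset.univ fun j _ =>
        (hexp k i j).smul_const (Matrix.single i j (1 : ℂ))
    refine hsum.congr (.of_forall fun ω => ?_)
    beta_reduce
    conv_rhs => rw [Matrix.matrix_eq_sum_single (NormedSpace.exp (-(θ • X k ω)))]
    simp [expNeg, Matrix.smul_single]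
  have hE : ∀ k, ∫ ω, NormedSpace.exp (-(θ • X k ω)) ∂P = expectation (expNeg θ (X k)) P :=
    fun k => by
    ext i j
    exact ((Matrix.entryLinearMap ℂ ℂ i j).toContinuousLinearMap.integral_comp_comm (hint k)).symm
  have hsa : ∀ k ω, IsSelfAdjoint (-(θ • X k ω)) := fun k ω =>
    ((IsSelfAdjoint.all θ).smul (hherm k ω)).neg
  have hind : iIndepFun (fun k ω => -(θ • X k ω)) P :=
    hindep.comp (fun _ a => -(θ • a)) fun _ => by
      exact (continuous_id.const_smul θ).neg.measurable
  have key := lintegral_expMin_add_sum_le hsa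
    (fun k => ((continuous_id.const_smul θ).neg.measurable.comp (hmeas k))) hind hint
    Finset.univ (IsSelfAdjoint.zero _)
  simp_rw [zero_add, hE, Finset.sum_neg_distrib, ← Finset.smul_sum] at key
  have hmono : ENNReal.ofReal (Real.exp (-(θ * ε))) * P {ω | lambdaMax (∑ k, X k ω) ≤ ε} ≤
      ∫⁻ ω, ENNReal.ofReal (expMin (-(θ • ∑ k, X k ω))) ∂P := by
    refine le_trans ?_ (mul_meas_ge_le_lintegral₀ (Measurable.aemeasurable ?_)
      (ENNReal.ofReal (Real.exp (-(θ * ε)))))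
    · gcongr with ω
      exact fun h => ENNReal.ofReal_le_ofReal
        (exp_neg_le_expMin_of_sSup_spectrum_le (isSelfAdjoint_sum _ fun k _ => hherm k ω) h hθ.le)
    · have hS : Measurable fun ω => ∑ k, X k ω := by fun_prop
      exact ((continuous_expMin.comp
        (continuous_id.const_smul θ).neg).measurable.comp hS).ennreal_ofReal
  have hlast := expMin_le_exp_sSup_spectrum (a := ∑ k, matLog (expectation (expNeg θ (X k)) P))
    (isSelfAdjoint_sum _ fun k _ => isHermitian_matLog _)
  have hfinal := hmono.trans (key.trans (ENNReal.ofReal_le_ofReal hlast))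
  rw [Real.exp_neg, ENNReal.ofReal_inv_of_pos (Real.exp_pos _), mul_comm, ← div_eq_mul_inv,
    ENNReal.div_le_iff (by simp [Real.exp_pos]) ENNReal.ofReal_ne_top,
    ← ENNReal.ofReal_mul (Real.exp_nonneg _), mul_comm] at hfinal
  exact hfinal

theorem mainTheorem1 {Ω : Type*} [MeasurableSpace Ω] (P : Measure Ω) [IsProbabilityMeasure P]
    (d : ℕ) [NeZero d] (K : ℕ) (X : Fin K → Ω → Matrix (Fin d) (Fin d) ℂ)
    (hmeas : ∀ k, Measurable (X k))
    (hherm : ∀ k ω, (X k ω).IsHermitian)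
    (hindep : iIndepFun X P)
    (ε : ℝ) (hε : 0 < ε) :
    P {ω | SmallDeviation.lambdaMax (∑ k, X k ω) ≤ ε} ≤
      ⨅ (θ : ℝ) (_ : 0 < θ)
        (_ : ∀ k, SmallDeviation.HasExpectation (SmallDeviation.expNeg θ (X k)) P),
        ENNReal.ofReal (Real.exp (θ * ε) *
          Real.exp (SmallDeviation.lambdaMax
            (∑ k, SmallDeviation.matLog
              (SmallDeviation.expectation (SmallDeviation.expNeg θ (X k)) P)))) :=
  le_iInf fun _ => le_iInf fun hθ => le_iInf fun hexp =>
    SmallDeviation.measure_lambdaMax_sum_le hmeas hherm hindep ε hθ hexp
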